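/- Let $k\ge 1$ and let $A_k$ be the Aztec diamond of size $k$, turned by $45^\circ$: its faces (internal and open) are the points $(x,y)\in\{0,\dots,2k\}^2$ with $x+y$ even, its vertices are the points of $\{0,\dots,2k\}^2$ with $x+y$ odd, a vertex being white if $x$ is even and black if $x$ is odd, and a white vertex $w$ and a black vertex $b$ are joined by an edge when $b-w=(\pm1,\pm1)$. The internal faces are those with $0<x,y<2k$; each is a square. The faces carry weights $a=(a_{x,y})$ in a commutative ring (for instance complex numbers or formal variables); write $c_{i,j}=a_{2i,2j}$ for $0\le i,j\le k$ and $d_{i,j}=a_{2i+1,2j+1}$ for $0\le i,j\le k-1$. For a directed edge $\vec e$ of $A_k$ let $f(\vec e)$ be the face on its right. A Kasteleyn orientation is a function $\varphi$ from the directed edges of $A_k$ to $\{-1,1\}$ with $\varphi_{(b,w)}=-\varphi_{(w,b)}$ such that the product of $\varphi_{(w,b)}$ over the four edges $wb$ around each internal face is $-1$. Let $$Z(A_k,a,\varphi)=\sum_{\vec M}\ \prod_{\vec e\in\vec M}\varphi_{\vec e}\,a_{f(\vec e)},$$ where the sum is over all oriented dimer configurations, i.e. perfect matchings of $A_k$ with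 a choice of direction for each edge. Let $G^\bullet$ be the graph whose vertices are the black vertices of $A_k$, written $b_{i,j}=(2i+1,2j)$ with $0\le i\le k-1$, $0\le j\le k$, and two extra vertices $b_r$ (on the left) and $\tilde b$ (on the right), with one edge crossing each face of $A_k$: for $0\le i,j\le k$ the horizontal edge $e_{i,j}$, crossing the face of weight $c_{i,j}$, joins $b_{i-1,j}$ and $b_{i,j}$, where $b_{-1,j}$ means $b_r$ and $b_{k,j}$ means $\tilde b$; for $0\le i,j\le k-1$ a vertical edge, crossing the face of weight $d_{i,j}$, joins $b_{i,j}$ and $b_{i,j+1}$. For a directed edge $\vec e$ of $G^\bullet$ let $b(\vec e)$ be its initial vertex and $f(\vec e)$ the face it crosses, and let $\operatorname{col} b_{i,j}=i$. For a permutation $\tau$ of $\{0,\dots,k\}$, let $\mathsf F(\tau)$ be the permutation spanning forest of $\tau$: the unique directed spanning forest of $G^\bullet$ rooted at $b_r,\tilde b$ (two trees, one containing each root, covering all vertices, with edges directed towards the root) which contains no vertical edge and in which the absent horizontal edges are exactly $e_{\tau(0),0},\dots,e_{\tau(k),k}$. **Theorem.** Let $\varphi$ be a Kasteleyn orientation of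 $A_k$. There is a sign $\epsilon\in\{-1,1\}$, which does not depend on the weights, such that for all face weights $a$ with $d_{i,j}=d_i$ for all $0\le i,j\le k-1$, for some $d_0,\dots,d_{k-1}$, $$Z(A_k,a,\varphi)=\epsilon\sum_{\tau\in\mathcal S_{k+1}}\operatorname{sgn}(\tau)\prod_{\vec e\in\mathsf F(\tau)}\bigl(a_{f(\vec e)}-d_{\operatorname{col} b(\vec e)}\bigr).$$ -/

import Mathlib

namespace AztecDSKP

/-! ### The Aztec diamond of size `k`, turned by 45 degrees

All objects are placed at integer points of the square `[0, 2k] × [0, 2k]`: the faces at the points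
`(x, y)` with `x + y` even, the vertices at the points with `x + y` odd (white ones with `x` even,
black ones with `x` odd). -/

/-- White vertices; `(i, j)` sits at the point `(2i, 2j+1)`. -/
abbrev White (k : ℕ) := Fin (k + 1) × Fin k

/-- Black vertices; `(i, j)` sits at the point `(2i+1, 2j)`. -/
abbrev Black (k : ℕ) := Fin k × Fin (k + 1)

/-- The faces, internal and open: `even i j` is the face at `(2i, 2j)`, whose weight is called
`c_{i,j}`, and `odd i j` is the face at `(2i+1, 2j+1)`, whose weight is called `d_{i,j}`. -/
inductive Face (k : ℕ) where
  | even (i j : Fin (k + 1)) : Face k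
  | odd (i j : Fin k) : Face k
deriving DecidableEq, Fintype

def White.pos {k : ℕ} (w : White k) : ℤ × ℤ := (2 * (w.1 : ℤ), 2 * (w.2 : ℤ) + 1)

def Black.pos {k : ℕ} (b : Black k) : ℤ × ℤ := (2 * (b.1 : ℤ) + 1, 2 * (b.2 : ℤ))

def Face.pos {k : ℕ} : Face k → ℤ × ℤ
  | .even i j => (2 * (i : ℤ), 2 * (j : ℤ))
  | .odd i j => (2 * (i : ℤ) + 1, 2 * (j : ℤ) + 1)

/-- Internal faces are those which do not touch the boundary of the square; the others are open.
They all have degree four. -/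
def Face.IsInternal {k : ℕ} (f : Face k) : Prop :=
  0 < f.pos.1 ∧ f.pos.1 < 2 * (k : ℤ) ∧ 0 < f.pos.2 ∧ f.pos.2 < 2 * (k : ℤ)

/-- Edges of the Aztec diamond: pairs of a white and a black vertex that are diagonal neighbours. -/
abbrev Edge (k : ℕ) :=
  {e : White k × Black k //
    |(Black.pos e.2).1 - (White.pos e.1).1| = 1 ∧ |(Black.pos e.2).2 - (White.pos e.1).2| = 1}

namespace Edge

variable {k : ℕ}

def white (e : Edge k) : White k := e.1.1

def black (e : Edge k) : Black k := e.1.2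

end Edge

/-- Directed edges of the Aztec diamond: `(e, true)` is directed from white to black,
`(e, false)` from black to white. -/
abbrev DEdge (k : ℕ) := Edge k × Bool

namespace DEdge

variable {k : ℕ}

/-- The same edge, directed the other way. -/
def rev (e : DEdge k) : DEdge k := (e.1, !e.2)

def tailPos (e : DEdge k) : ℤ × ℤ := if e.2 then White.pos e.1.white else Black.pos e.1.black

def headPos (e : DEdge k) : ℤ × ℤ := if e.2 then Black.pos e.1.black else White.pos e.1.white

/-- The even face next to an edge, at the point with the abscissa of the white end
and the ordinate of the black end. -/
def evenFace (e : DEdge k) : Face k := .even e.1.white.1 e.1.black.2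

/-- The odd face next to an edge, at the point with the abscissa of the black end
and the ordinate of the white end. -/
def oddFace (e : DEdge k) : Face k := .odd e.1.black.1 e.1.white.2

end DEdge

/-- The point `r` lies strictly to the right of the line directed from `p` to `q`. -/
def OnRight (p q r : ℤ × ℤ) : Prop :=
  (q.1 - p.1) * (r.2 - p.2) - (q.2 - p.2) * (r.1 - p.1) < 0

instance (p q r : ℤ × ℤ) : Decidable (OnRight p q r) := by
  unfold OnRight; infer_instance

/-- The face `f(e)` on the right of the directed edge `e`. -/
def DEdge.rightFace {k : ℕ} (e : DEdge k) : Face k :=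
  if OnRight e.tailPos e.headPos e.oddFace.pos then e.oddFace else e.evenFace

/-- Kasteleyn orientations: skew-symmetric functions on directed edges with values in `{-1, 1}`
such that, around every internal face (of degree `4 = 2 · 2`), the product of the values on the
edges directed from white to black is `(-1)^(2+1) = -1`. -/
structure IsKasteleyn {k : ℕ} (φ : DEdge k → ℤˣ) : Prop where
  skew : ∀ e, φ e.rev = - φ e
  face : ∀ f : Face k, f.IsInternal →
    ∏ e : Edge k with DEdge.rightFace (e, true) = f ∨ DEdge.rightFace (e, false) = f,
      φ (e, true) = -1

/-- Oriented dimer configurations: sets of directed edges such that every vertex, white or black,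
is an end of exactly one of them. -/
def IsOrientedDimer {k : ℕ} (M : Finset (DEdge k)) : Prop :=
  (∀ w : White k, ∃! e, e ∈ M ∧ e.1.white = w) ∧ (∀ b : Black k, ∃! e, e ∈ M ∧ e.1.black = b)

open Classical in
/-- The partition function `Z(A_k, a, φ)` of oriented dimer configurations. -/
noncomputable def partitionFunction {R : Type*} [CommRing R] (k : ℕ) (a : Face k → R)
    (φ : DEdge k → ℤˣ) : R :=
  ∑ M : Finset (DEdge k) with IsOrientedDimer M, ∏ e ∈ M, ((φ e : ℤ) : R) * a e.rightFace

/-! ### The graph of black diagonals and its permutation spanning forests -/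

/-- Vertices of the graph `G^•`: the black vertices of the Aztec diamond, the extra vertex `left`
(called `b_r`) on its left, and the extra vertex `right` (called `b̃`) on its right. -/
inductive BVertex (k : ℕ) where
  | left : BVertex k
  | right : BVertex k
  | black (b : Black k) : BVertex k
deriving DecidableEq, Fintype

/-- The edges of `G^•` are the black diagonals of the faces, one for each face. The diagonal of
`even i j` is the horizontal edge `e_{i,j}`, the diagonal of `odd i j` is a vertical edge. This is
the left end of a horizontal edge and the bottom end of a vertical one. -/
def Face.end₀ {k : ℕ} : Face k → BVertex k
  | .even i j => Fin.cases (motive := fun _ => BVertex k) .left (fun i' => .black (i', j)) i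
  | .odd i j => .black (i, j.castSucc)

/-- The right end of a horizontal edge and the top end of a vertical one. -/
def Face.end₁ {k : ℕ} : Face k → BVertex k
  | .even i j => Fin.lastCases (motive := fun _ => BVertex k) .right (fun i' => .black (i', j)) i
  | .odd i j => .black (i, j.succ)

/-- Directed edges of `G^•`: `(f, true)` crosses the face `f` from left to right or from bottom
to top, `(f, false)` crosses it the other way. -/
abbrev BEdge (k : ℕ) := Face k × Bool

namespace BEdge

variable {k : ℕ}

/-- The face `f(e)` crossed by the directed edge `e`. -/
def face (e : BEdge k) : Face k := e.1

/-- The initial vertex `b(e)` of the directed edge `e`. -/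
def tail (e : BEdge k) : BVertex k := if e.2 then e.1.end₀ else e.1.end₁

def head (e : BEdge k) : BVertex k := if e.2 then e.1.end₁ else e.1.end₀

end BEdge

/-- Directed spanning forests of `G^•` with a given root set: no edge leaves a root, exactly one
edge leaves each other vertex, and following the edges leads from every vertex to a root. (So the
components are trees, each has exactly one root and is directed towards it, and together they
cover all vertices.) -/
structure IsSpanningForest {k : ℕ} (roots : Set (BVertex k)) (F : Finset (BEdge k)) : Prop where
  root : ∀ v ∈ roots, ∀ e ∈ F, e.tail ≠ v
  out : ∀ v, v ∉ roots → ∃! e, e ∈ F ∧ e.tail = v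
  reach : ∀ v, ∃ r ∈ roots,
    Relation.ReflTransGen (fun x y => ∃ e ∈ F, BEdge.tail e = x ∧ BEdge.head e = y) v r

/-- `F` is a permutation spanning forest of `G^•` with permutation `τ`: a spanning forest rooted at
`b_r` and `b̃`, without vertical edges, in which the absent horizontal edges are exactly
`e_{τ(0),0}, …, e_{τ(k),k}`. -/
structure IsPermForest {k : ℕ} (τ : Equiv.Perm (Fin (k + 1))) (F : Finset (BEdge k)) : Prop where
  forest : IsSpanningForest {BVertex.left, BVertex.right} F
  not_vertical : ∀ e ∈ F, ∀ i j, BEdge.face e ≠ .odd i j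
  absent : ∀ i j, (∀ e ∈ F, BEdge.face e ≠ .even i j) ↔ i = τ j

/-- The directed edge `e` is horizontal, distinct from the edges `e_{τ(j),j}`, and directed away
from the one of them in its row. -/
def InPermForest {k : ℕ} (τ : Equiv.Perm (Fin (k + 1))) : BEdge k → Prop
  | (.even i j, false) => i < τ j
  | (.even i j, true) => τ j < i
  | (.odd _ _, _) => False

open Classical in
/-- The permutation spanning forest `F(τ)`; see `isPermForest_iff`. -/
noncomputable def permForest {k : ℕ} (τ : Equiv.Perm (Fin (k + 1))) : Finset (BEdge k) :=
  {e : BEdge k | InPermForest τ e}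

section PermForest

variable {k : ℕ}

theorem end₀_zero (j : Fin (k + 1)) : (Face.even 0 j).end₀ = BVertex.left := rfl

theorem end₀_succ (i : Fin k) (j : Fin (k + 1)) :
    (Face.even i.succ j).end₀ = BVertex.black (i, j) := rfl

theorem end₁_last (j : Fin (k + 1)) :
    (Face.even (Fin.last k) j).end₁ = BVertex.right := by simp [Face.end₁]

theorem end₁_castSucc (i : Fin k) (j : Fin (k + 1)) :
    (Face.even i.castSucc j).end₁ = BVertex.black (i, j) := by simp [Face.end₁]

theorem mem_permForest (τ : Equiv.Perm (Fin (k + 1))) (e : BEdge k) :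
    e ∈ permForest τ ↔ InPermForest τ e := by simp [permForest]

theorem tail_of_lt {i : Fin (k + 1)} {j : Fin (k + 1)} {t : Fin (k + 1)} (h : i < t) :
    ∃ i' : Fin k, i = i'.castSucc ∧ BEdge.tail (.even i j, false) = .black (i', j) := by
  induction i using Fin.lastCases with
  | last => exact absurd h (not_lt.2 (Fin.le_last t))
  | cast i' => exact ⟨i', rfl, by simp [BEdge.tail, end₁_castSucc]⟩

theorem tail_of_gt {i : Fin (k + 1)} {j : Fin (k + 1)} {t : Fin (k + 1)} (h : t < i) :
    ∃ i' : Fin k, i = i'.succ ∧ BEdge.tail (.even i j, true) = .black (i', j) := by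
  induction i using Fin.cases with
  | zero => exact absurd h (not_lt.2 (Fin.zero_le t))
  | succ i' => exact ⟨i', rfl, by simp [BEdge.tail, end₀_succ]⟩

theorem isPermForest_permForest (τ : Equiv.Perm (Fin (k + 1))) :
    IsPermForest τ (permForest τ) := by
  have htail : ∀ e ∈ permForest τ, ∃ i j, BEdge.tail e = .black (i, j) ∧
      ((i.castSucc < τ j ∧ e = (.even i.castSucc j, false)) ∨
        (τ j < i.succ ∧ e = (.even i.succ j, true))) := by
    intro e he
    rw [mem_permForest] at he
    rcases e with ⟨⟨i, j⟩ | ⟨i, j⟩, s⟩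
    · cases s
      · obtain ⟨i', rfl, h⟩ := tail_of_lt (j := j) he
        exact ⟨i', j, h, Or.inl ⟨he, rfl⟩⟩
      · obtain ⟨i', rfl, h⟩ := tail_of_gt (j := j) he
        exact ⟨i', j, h, Or.inr ⟨he, rfl⟩⟩
    · cases s <;> exact he.elim
  refine ⟨⟨?_, ?_, ?_⟩, ?_, ?_⟩
  · intro v hv e he h
    obtain ⟨i, j, h', -⟩ := htail e he
    rw [h'] at h
    subst h
    simp at hv
  · intro v hv
    rcases v with _ | _ | ⟨i, j⟩
    · simp at hv
    · simp at hv
    rcases lt_or_ge i.castSucc (τ j) with hlt | hge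
    · refine ⟨(.even i.castSucc j, false), ⟨(mem_permForest _ _).2 hlt,
        by simp [BEdge.tail, end₁_castSucc]⟩, ?_⟩
      rintro e ⟨he, ht⟩
      obtain ⟨i', j', h', h⟩ := htail e he
      rw [h'] at ht
      simp only [BVertex.black.injEq, Prod.mk.injEq] at ht
      obtain ⟨rfl, rfl⟩ := ht
      rcases h with h | h
      · exact h.2
      · have := h.1
        simp only [Fin.lt_def, Fin.val_succ, Fin.val_castSucc] at this hlt
        omega
    · have hlt : τ j < i.succ := by
        simp only [Fin.le_def, Fin.lt_def, Fin.val_succ, Fin.val_castSucc] at *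
        omega
      refine ⟨(.even i.succ j, true), ⟨(mem_permForest _ _).2 hlt,
        by simp [BEdge.tail, end₀_succ]⟩, ?_⟩
      rintro e ⟨he, ht⟩
      obtain ⟨i', j', h', h⟩ := htail e he
      rw [h'] at ht
      simp only [BVertex.black.injEq, Prod.mk.injEq] at ht
      obtain ⟨rfl, rfl⟩ := ht
      rcases h with h | h
      · exact absurd h.1 (not_lt.2 hge)
      · exact h.2
  · have hl : ∀ (j : Fin (k + 1)) (n : ℕ) (i : Fin k), (i : ℕ) = n → i.castSucc < τ j →
        Relation.ReflTransGen
          (fun x y => ∃ e ∈ permForest τ, BEdge.tail e = x ∧ BEdge.head e = y)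
          (.black (i, j)) .left := by
      intro j n
      induction n with
      | zero =>
        intro i hi hlt
        refine .single ⟨(.even i.castSucc j, false), (mem_permForest _ _).2 hlt,
          by simp [BEdge.tail, end₁_castSucc], ?_⟩
        have : i.castSucc = 0 := by ext; simpa using hi
        simp [BEdge.head, this, end₀_zero]
      | succ n ih =>
        intro i hi hlt
        have hn : n < k := by omega
        have e1 : i.castSucc = (⟨n, hn⟩ : Fin k).succ := by ext; simpa using hi
        refine .head ⟨(.even i.castSucc j, false), (mem_permForest _ _).2 hlt,
          by simp [BEdge.tail, end₁_castSucc], rfl⟩ ?_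
        have : BEdge.head (.even i.castSucc j, false) = .black (⟨n, hn⟩, j) := by
          rw [e1]; exact end₀_succ ⟨n, hn⟩ j
        rw [this]
        refine ih _ rfl ?_
        simp only [Fin.lt_def, Fin.val_castSucc] at *
        omega
    have hr : ∀ (j : Fin (k + 1)) (n : ℕ) (i : Fin k), (i : ℕ) + n + 1 = k → τ j < i.succ →
        Relation.ReflTransGen
          (fun x y => ∃ e ∈ permForest τ, BEdge.tail e = x ∧ BEdge.head e = y)
          (.black (i, j)) .right := by
      intro j n
      induction n with
      | zero =>
        intro i hi hlt
        refine .single ⟨(.even i.succ j, true), (mem_permForest _ _).2 hlt,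
          by simp [BEdge.tail, end₀_succ], ?_⟩
        have : i.succ = Fin.last k := by ext; simpa using hi
        simp [BEdge.head, this, end₁_last]
      | succ n ih =>
        intro i hi hlt
        have hn : (i : ℕ) + 1 < k := by omega
        have e1 : i.succ = (⟨i + 1, hn⟩ : Fin k).castSucc := by ext; simp
        refine .head ⟨(.even i.succ j, true), (mem_permForest _ _).2 hlt,
          by simp [BEdge.tail, end₀_succ], rfl⟩ ?_
        have : BEdge.head (.even i.succ j, true) = .black (⟨i + 1, hn⟩, j) := by
          rw [e1]; exact end₁_castSucc ⟨i + 1, hn⟩ j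
        rw [this]
        refine ih _ (by simp only []; omega) ?_
        simp only [Fin.lt_def, Fin.val_succ] at *
        omega
    intro v
    rcases v with _ | _ | ⟨i, j⟩
    · exact ⟨.left, by simp, .refl⟩
    · exact ⟨.right, by simp, .refl⟩
    rcases lt_or_ge i.castSucc (τ j) with hlt | hge
    · exact ⟨.left, by simp, hl j _ i rfl hlt⟩
    · refine ⟨.right, by simp, hr j (k - 1 - i) i (by omega) ?_⟩
      simp only [Fin.le_def, Fin.lt_def, Fin.val_succ, Fin.val_castSucc] at *
      omega
  · intro e he i j h
    rw [mem_permForest] at he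
    rcases e with ⟨f, s⟩
    obtain rfl : f = .odd i j := h
    cases s <;> exact he
  · intro i j
    constructor
    · intro h
      rcases lt_trichotomy i (τ j) with h' | h' | h'
      · exact absurd rfl (h (.even i j, false) ((mem_permForest _ _).2 h'))
      · exact h'
      · exact absurd rfl (h (.even i j, true) ((mem_permForest _ _).2 h'))
    · rintro rfl ⟨f, s⟩ he h
      rw [mem_permForest] at he
      obtain rfl : f = .even (τ j) j := h
      cases s <;> exact lt_irrefl _ he

/-- `permForest τ` is the unique permutation spanning forest with permutation `τ`. -/
theorem isPermForest_iff (τ : Equiv.Perm (Fin (k + 1))) (F : Finset (BEdge k)) :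
    IsPermForest τ F ↔ F = permForest τ := by
  constructor
  swap
  · rintro rfl
    exact isPermForest_permForest τ
  intro hF
  have hpres : ∀ i j, i ≠ τ j → (.even i j, false) ∈ F ∨ (.even i j, true) ∈ F := by
    intro i j hij
    by_contra hcon
    rw [not_or] at hcon
    refine hij ((hF.absent i j).1 ?_)
    rintro ⟨f, s⟩ he h
    obtain rfl : f = .even i j := h
    cases s
    · exact hcon.1 he
    · exact hcon.2 he
  have huniq : ∀ (i : Fin k) (j : Fin (k + 1)), ((.even i.castSucc j, false) : BEdge k) ∈ F →
      ((.even i.succ j, true) : BEdge k) ∈ F → False := by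
    intro i j h1 h2
    obtain ⟨e, -, he⟩ := hF.forest.out (.black (i, j)) (by simp)
    have e1 := he _ ⟨h1, by simp [BEdge.tail, end₁_castSucc]⟩
    have e2 := he _ ⟨h2, by simp [BEdge.tail, end₀_succ]⟩
    have := e1.trans e2.symm
    simp at this
  have hl : ∀ (j : Fin (k + 1)) (n : ℕ) (i : Fin (k + 1)), (i : ℕ) = n → i < τ j →
      ((.even i j, true) : BEdge k) ∉ F := by
    intro j n
    induction n with
    | zero =>
      intro i hi hlt hmem
      obtain rfl : i = 0 := by ext; simpa using hi
      exact hF.forest.root .left (by simp) _ hmem rfl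
    | succ n ih =>
      intro i hi hlt hmem
      have hn : n < k := by omega
      obtain rfl : i = (⟨n, hn⟩ : Fin k).succ := by ext; simpa using hi
      have hlt' : (⟨n, hn⟩ : Fin k).castSucc < τ j := by
        simp only [Fin.lt_def, Fin.val_castSucc, Fin.val_succ] at *
        omega
      exact huniq _ _ ((hpres _ _ hlt'.ne).resolve_right (ih _ rfl hlt')) hmem
  have hr : ∀ (j : Fin (k + 1)) (n : ℕ) (i : Fin (k + 1)), (i : ℕ) + n = k → τ j < i →
      ((.even i j, false) : BEdge k) ∉ F := by
    intro j n
    induction n with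
    | zero =>
      intro i hi hlt hmem
      obtain rfl : i = Fin.last k := by ext; simpa using hi
      exact hF.forest.root .right (by simp) _ hmem (by simp [BEdge.tail, end₁_last])
    | succ n ih =>
      intro i hi hlt hmem
      have hn : (i : ℕ) < k := by omega
      obtain ⟨i, rfl⟩ : ∃ i' : Fin k, i = i'.castSucc := ⟨⟨i, hn⟩, by ext; simp⟩
      have hlt' : τ j < i.succ := by
        simp only [Fin.lt_def, Fin.val_succ, Fin.val_castSucc] at *
        omega
      refine huniq _ _ hmem ((hpres _ _ hlt'.ne').resolve_left (ih _ ?_ hlt'))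
      simp only [Fin.val_succ, Fin.val_castSucc] at *
      omega
  ext ⟨f, s⟩
  rw [mem_permForest]
  rcases f with ⟨i, j⟩ | ⟨i, j⟩
  · rcases lt_trichotomy i (τ j) with h | h | h
    · cases s
      · exact ⟨fun _ => h, fun _ => (hpres _ _ h.ne).resolve_right (hl _ _ _ rfl h)⟩
      · exact ⟨fun h' => absurd h' (hl _ _ _ rfl h), fun h' => absurd h' h.asymm⟩
    · have := (hF.absent i j).2 h
      refine ⟨fun h' => absurd rfl (this _ h'), fun h' => ?_⟩
      cases s
      · exact absurd h h'.ne
      · exact absurd h h'.ne'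
    · cases s
      · exact ⟨fun h' => absurd h' (hr _ (k - i) _ (by omega) h), fun h' => absurd h' h.asymm⟩
      · exact ⟨fun _ => h, fun _ => (hpres _ _ h.ne').resolve_left (hr _ (k - i) _ (by omega) h)⟩
  · refine ⟨fun h' => absurd rfl (hF.not_vertical _ h' i j), fun h' => ?_⟩
    cases s <;> exact h'.elim

end PermForest

/-- The weight `d_{col b}` attached to a vertex `b` of `G^•` other than `b_r`, `b̃`, where `col b`
is the label of its column. No edge of a permutation spanning forest leaves `b_r` or `b̃`, so the
value `0` there is never used. -/
def colWeight {R : Type*} [CommRing R] {k : ℕ} (d : Fin k → R) : BVertex k → R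
  | .black b => d b.1
  | .left => 0
  | .right => 0

end AztecDSKP

namespace AztecDSKP

open Equiv

/-! ### Signed sums over matchings with weights constant along columns -/

section Combinatorics

variable {k : ℕ}

/-! Summing over the two directions of each edge turns `Z` into a sum over bijections from black to
white vertices: the directions have opposite signs and the two adjacent faces on their right, so an
edge contributes `±(c - d)`.

Up to a gauge change at the vertices there is only one Kasteleyn orientation, because the ratio of
two has product `1` around every internal face and is therefore a product of vertex signs
(`exists_potential`). Each vertex is matched once, so these signs come out as the global `ε`, and
`refSign` remains.

If `d` depends only on the column, `c - d` is determined by the column of the white end and by the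
black end. When two black vertices of one row are matched to one column, exchanging their partners
keeps the weights and flips the sign, so such matchings cancel (`sum_not_rowInjective`). In the
others every row omits exactly one column and every column exactly one row; the omissions form a
permutation `τ` that determines the matching (`exists_eq_permMatching`). Its negative edges
correspond to the inversions of `τ` (`prod_refSign_permMatching`), and its edge at `b` touches the
even face crossed by the forest edge leaving `b` (`prod_permForest`). -/

/-- A white vertex and a black vertex are diagonal neighbours. -/
def Adj (w : White k) (b : Black k) : Prop :=
  (w.1 = b.1.castSucc ∨ w.1 = b.1.succ) ∧ (b.2 = w.2.castSucc ∨ b.2 = w.2.succ)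

instance (w : White k) (b : Black k) : Decidable (Adj w b) := by
  unfold Adj; infer_instance

/-- The reference sign of an edge: `-1` if and only if the black end lies to the left of and above
the white end. -/
def refSign (w : White k) (b : Black k) : ℤˣ :=
  if w.1 = b.1.succ ∧ b.2 = w.2.succ then -1 else 1

/-- The signed weight of a pair of vertices; it depends on the row of the white vertex only through
the adjacency and the sign. -/
def signedWeight {R : Type*} [CommRing R] (c : Fin (k + 1) → Fin (k + 1) → R) (d : Fin k → R)
    (w : White k) (b : Black k) : R :=
  if Adj w b then ((refSign w b : ℤ) : R) * (c w.1 b.2 - d b.1) else 0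

/-- Black vertices of the same row are matched to different columns. -/
def RowInjective (σ : Black k ≃ White k) : Prop :=
  ∀ b b' : Black k, b.2 = b'.2 → (σ b).1 = (σ b').1 → b = b'

/-! ### Cancellation around even faces -/

/-- If either pairing consists of edges, the four vertices surround one even face and all four pairs
are adjacent. Both products then contain the same two factors `c - d`, and exactly one of the four
edges has sign `-1`. Otherwise both sides vanish. -/
theorem signedWeight_swap {R : Type*} [CommRing R] (c : Fin (k + 1) → Fin (k + 1) → R)
    (d : Fin k → R) {w w' : White k} {b b' : Black k} (hw : w.1 = w'.1) (hww : w ≠ w')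
    (hb : b.2 = b'.2) (hbb : b ≠ b') :
    signedWeight c d w b * signedWeight c d w' b' =
      -(signedWeight c d w' b * signedWeight c d w b') := by
  obtain ⟨i, j⟩ := w
  obtain ⟨i', j'⟩ := w'
  obtain ⟨m, n⟩ := b
  obtain ⟨m', n'⟩ := b'
  simp only at hw hb
  subst hw hb
  have hj : (j : ℕ) ≠ j' := fun h => hww (by rw [Fin.ext h])
  have hm : (m : ℕ) ≠ m' := fun h => hbb (by rw [Fin.ext h])
  simp only [signedWeight, refSign, Adj, Fin.ext_iff, Fin.val_castSucc, Fin.val_succ]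
  split_ifs <;> first | omega | (simp; done) | (simp; ring)

open Classical in
/-- A transposition of two black vertices of the same row with the same value of `f`, if any. -/
noncomputable def rowSwap (f : Black k → Fin (k + 1)) : Perm (Black k) :=
  if h : ∃ p : Black k × Black k, p.1.2 = p.2.2 ∧ f p.1 = f p.2 ∧ p.1 ≠ p.2 then
    swap h.choose.1 h.choose.2 else 1

theorem exists_rowSwap_eq {σ : Black k ≃ White k} (h : ¬ RowInjective σ) :
    ∃ b b' : Black k, b.2 = b'.2 ∧ (σ b).1 = (σ b').1 ∧ b ≠ b' ∧
      rowSwap (fun x => (σ x).1) = swap b b' := by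
  have h' : ∃ p : Black k × Black k, p.1.2 = p.2.2 ∧ (σ p.1).1 = (σ p.2).1 ∧ p.1 ≠ p.2 := by
    simp only [RowInjective, not_forall] at h
    obtain ⟨b, b', h1, h2, h3⟩ := h
    exact ⟨(b, b'), h1, h2, h3⟩
  obtain ⟨h1, h2, h3⟩ := h'.choose_spec
  exact ⟨_, _, h1, h2, h3, dif_pos h'⟩

/-- `rowSwap` sees a matching only through its columns. As these do not change, the same
transposition is chosen after the exchange, which makes the exchange an involution. -/
theorem col_swap_trans {σ : Black k ≃ White k} {b b' : Black k} (h : (σ b).1 = (σ b').1) :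
    (fun x => (((swap b b').trans σ) x).1) = fun x => (σ x).1 := by
  ext x
  simp only [trans_apply, swap_apply_def]
  split_ifs with h1 h2
  · rw [h1, h]
  · rw [h2, h]
  · rfl

theorem not_rowInjective_swap {σ : Black k ≃ White k} {b b' : Black k} (hb : b.2 = b'.2)
    (h : (σ b).1 = (σ b').1) (hbb : b ≠ b') : ¬ RowInjective ((swap b b').trans σ) := by
  intro hr
  refine hbb (hr b b' hb ?_)
  simp [h]

theorem sum_not_rowInjective {R : Type*} [CommRing R] (c : Fin (k + 1) → Fin (k + 1) → R)
    (d : Fin k → R) [DecidablePred (RowInjective (k := k))] :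
    ∑ σ : Black k ≃ White k with ¬ RowInjective σ, ∏ b, signedWeight c d (σ b) b = 0 := by
  classical
  refine Finset.sum_involution (fun σ _ => (rowSwap fun x => (σ x).1).trans σ) ?_ ?_ ?_ ?_
  · intro σ hσ
    obtain ⟨b, b', hb, hw, hbb, hs⟩ := exists_rowSwap_eq (Finset.mem_filter.1 hσ).2
    rw [hs, ← Finset.mul_prod_erase _ _ (Finset.mem_univ b),
      ← Finset.mul_prod_erase (a := b') _ _ (by simp [hbb.symm]),
      ← Finset.mul_prod_erase (Finset.univ : Finset (Black k)) _ (Finset.mem_univ b),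
      ← Finset.mul_prod_erase (a := b') (Finset.univ.erase b) _ (by simp [hbb.symm]),
      ← mul_assoc, ← mul_assoc, signedWeight_swap c d hw (σ.injective.ne hbb) hb hbb]
    have : ∏ x ∈ (Finset.univ.erase b).erase b', signedWeight c d (((swap b b').trans σ) x) x =
        ∏ x ∈ (Finset.univ.erase b).erase b', signedWeight c d (σ x) x := by
      refine Finset.prod_congr rfl fun x hx => ?_
      simp only [Finset.mem_erase, Finset.mem_univ, and_true] at hx
      rw [trans_apply, swap_apply_of_ne_of_ne hx.2 hx.1]
    rw [this]
    simp only [trans_apply, swap_apply_left, swap_apply_right]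
    ring
  · intro σ hσ _ h
    obtain ⟨b, b', hb, hw, hbb, hs⟩ := exists_rowSwap_eq (Finset.mem_filter.1 hσ).2
    rw [hs] at h
    have := congrArg (fun e : Black k ≃ White k => e b) h
    simp only [trans_apply, swap_apply_left] at this
    exact hbb (σ.injective this.symm)
  · intro σ hσ
    obtain ⟨b, b', hb, hw, hbb, hs⟩ := exists_rowSwap_eq (Finset.mem_filter.1 hσ).2
    rw [hs]
    simpa using not_rowInjective_swap hb hw hbb
  · intro σ hσ
    obtain ⟨b, b', hb, hw, hbb, hs⟩ := exists_rowSwap_eq (Finset.mem_filter.1 hσ).2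
    simp only [hs, col_swap_trans hw]
    ext1 x
    simp

/-! ### Row-injective matchings and permutations -/

/-- Steps by `0` or `1` together with injectivity force strict monotonicity, and a strictly monotone
map is determined by its range, which here omits a single point. -/
theorem eq_succAbove_of_injective {n : ℕ} {f : Fin n → Fin (n + 1)} (hf : Function.Injective f)
    (h : ∀ i, f i = i.castSucc ∨ f i = i.succ) : ∃ t : Fin (n + 1), f = t.succAbove := by
  have hmono : StrictMono f := by
    intro i i' hlt
    have hne : (f i : ℕ) ≠ f i' := fun h' => hlt.ne (hf (Fin.ext h'))
    rcases h i with h1 | h1 <;> rcases h i' with h2 | h2 <;>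
      simp only [h1, h2, Fin.lt_def, Fin.val_castSucc, Fin.val_succ] at * <;> omega
  have hcard : (Finset.univ.image f)ᶜ.card = 1 := by
    rw [Finset.card_compl, Finset.card_image_of_injective _ hf]
    simp
  obtain ⟨t, ht⟩ := Finset.card_eq_one.1 hcard
  refine ⟨t, (hmono.range_inj (Fin.strictMono_succAbove t)).1 ?_⟩
  rw [Fin.range_succAbove, ← Finset.coe_singleton, ← ht]
  simp

theorem succAbove_finSuccAboveEquiv_symm {n : ℕ} (p : Fin (n + 1)) (x : {x // x ≠ p}) :
    p.succAbove ((finSuccAboveEquiv p).symm x) = x :=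
  congrArg Subtype.val ((finSuccAboveEquiv p).apply_symm_apply x)

/-- The function underlying `permMatching`. -/
noncomputable def permMatchingFun (τ : Perm (Fin (k + 1))) (b : Black k) : White k :=
  ((τ b.2).succAbove b.1, (finSuccAboveEquiv (τ.symm ((τ b.2).succAbove b.1))).symm
    ⟨b.2, fun h => Fin.succAbove_ne (τ b.2) b.1 ((symm_apply_eq τ).1 h.symm)⟩)

theorem succAbove_permMatchingFun_snd (τ : Perm (Fin (k + 1))) (b : Black k) :
    (τ.symm (permMatchingFun τ b).1).succAbove (permMatchingFun τ b).2 = b.2 :=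
  succAbove_finSuccAboveEquiv_symm _ _

theorem permMatchingFun_injective (τ : Perm (Fin (k + 1))) :
    Function.Injective (permMatchingFun τ) := by
  intro b b' h
  have h2 : b.2 = b'.2 := by
    rw [← succAbove_permMatchingFun_snd τ b, h, succAbove_permMatchingFun_snd]
  refine Prod.ext (Fin.succAbove_right_injective (p := τ b.2) ?_) h2
  have : (τ b.2).succAbove b.1 = (τ b'.2).succAbove b'.1 := congrArg Prod.fst h
  rwa [← h2] at this

/-- The matching in which column `τ j` is the one not used by row `j`. -/
noncomputable def permMatching (τ : Perm (Fin (k + 1))) : Black k ≃ White k :=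
  Equiv.ofBijective (permMatchingFun τ) ((Fintype.bijective_iff_injective_and_card _).2
    ⟨permMatchingFun_injective τ, by simp [mul_comm]⟩)

theorem permMatching_fst (τ : Perm (Fin (k + 1))) (b : Black k) :
    (permMatching τ b).1 = (τ b.2).succAbove b.1 := rfl

theorem succAbove_permMatching_snd (τ : Perm (Fin (k + 1))) (b : Black k) :
    (τ.symm (permMatching τ b).1).succAbove (permMatching τ b).2 = b.2 :=
  succAbove_permMatchingFun_snd τ b

theorem succAbove_eq_or {n : ℕ} (p : Fin (n + 1)) (i : Fin n) :
    p.succAbove i = i.castSucc ∨ p.succAbove i = i.succ := by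
  unfold Fin.succAbove
  split_ifs <;> simp

theorem adj_permMatching (τ : Perm (Fin (k + 1))) (b : Black k) : Adj (permMatching τ b) b := by
  refine ⟨succAbove_eq_or _ _, ?_⟩
  have := succAbove_eq_or (τ.symm (permMatching τ b).1) (permMatching τ b).2
  rwa [succAbove_permMatching_snd] at this

theorem rowInjective_permMatching (τ : Perm (Fin (k + 1))) : RowInjective (permMatching τ) := by
  intro b b' h2 h
  rw [permMatching_fst, permMatching_fst, ← h2] at h
  exact Prod.ext (Fin.succAbove_right_injective h) h2

theorem permMatching_injective : Function.Injective (permMatching (k := k)) := by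
  intro τ τ' h
  ext1 j
  refine Fin.succAbove_left_injective (funext fun i => ?_)
  rw [← permMatching_fst τ (i, j), h, permMatching_fst]

/-- Row `j` omits a column `t j` and column `i` omits a row `u i`. Row `j` uses column `i` exactly
when column `i` uses row `j`, so `t` and `u` are mutually inverse. -/
theorem exists_eq_permMatching {σ : Black k ≃ White k} (hσ : ∀ b, Adj (σ b) b)
    (hr : RowInjective σ) : ∃ τ, permMatching τ = σ := by
  have hrow : ∀ j : Fin (k + 1), ∃ t : Fin (k + 1), (fun i => (σ (i, j)).1) = t.succAbove :=
    fun j => eq_succAbove_of_injective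
      (fun i i' h => congrArg Prod.fst (hr (i, j) (i', j) rfl h)) fun i => (hσ (i, j)).1
  have hcol : ∀ i : Fin (k + 1), ∃ t : Fin (k + 1),
      (fun j => (σ.symm (i, j)).2) = t.succAbove := by
    -- Row injectivity read from the white side: two white vertices of one column cannot have
    -- partners in the same row.
    refine fun i => eq_succAbove_of_injective (fun j j' h => ?_) fun j => ?_
    · have := hr _ _ h (by simp)
      simpa using this
    · simpa using (hσ (σ.symm (i, j))).2
  choose t ht using hrow
  choose u hu using hcol
  have h1 : ∀ i j, i ≠ t j → j ≠ u i := by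
    rintro i j hij rfl
    obtain ⟨z, hz⟩ := Fin.exists_succAbove_eq hij
    rw [← ht] at hz
    have := congrFun (hu i) (σ (z, u i)).2
    have e : (i, (σ (z, u i)).2) = σ (z, u i) := Prod.ext hz.symm rfl
    rw [e] at this
    simp only [symm_apply_apply] at this
    exact Fin.succAbove_ne _ _ this.symm
  have h2 : ∀ i j, j ≠ u i → i ≠ t j := by
    rintro i j hij rfl
    obtain ⟨z, hz⟩ := Fin.exists_succAbove_eq hij
    rw [← hu] at hz
    have := congrFun (ht j) (σ.symm (t j, z)).1
    have e : ((σ.symm (t j, z)).1, j) = σ.symm (t j, z) := Prod.ext rfl hz.symm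
    rw [e] at this
    simp only [apply_symm_apply] at this
    exact Fin.succAbove_ne _ _ this.symm
  let τ : Perm (Fin (k + 1)) :=
    ⟨t, u, fun j => by_contra fun h => h2 (t j) j (Ne.symm h) rfl,
      fun i => by_contra fun h => h1 i (u i) (Ne.symm h) rfl⟩
  refine ⟨τ, Equiv.ext fun b => ?_⟩
  have hfst : (permMatching τ b).1 = (σ b).1 := (congrFun (ht b.2) b.1).symm
  refine Prod.ext hfst (Fin.succAbove_right_injective (p := u (σ b).1) ?_)
  have e1 : (u (permMatching τ b).1).succAbove (permMatching τ b).2 = b.2 :=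
    succAbove_permMatching_snd τ b
  rw [hfst] at e1
  rw [e1, ← congrFun (hu (σ b).1) (σ b).2]
  simp

/-! ### Sign and weight of the matching of a permutation -/

theorem succAbove_eq_succ_iff {n : ℕ} (p : Fin (n + 1)) (i : Fin n) :
    p.succAbove i = i.succ ↔ p < p.succAbove i := by
  rcases lt_or_ge i.castSucc p with h | h
  · simp [Fin.succAbove_of_castSucc_lt _ _ h, Fin.ext_iff, h.le]
  · simpa [Fin.succAbove_of_le_castSucc _ _ h, Fin.lt_def, Fin.le_def, Nat.lt_succ_iff] using h

/-- The edge joining row `j` to column `i = τ m` goes left exactly when `τ j < τ m`, and up exactly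
when `m < j`. Hence the sign `-1` occurs once for each inversion. -/
theorem prod_refSign_permMatching (τ : Perm (Fin (k + 1))) :
    ∏ b, refSign (permMatching τ b) b = Perm.sign τ := by
  have key : ∀ b : Black k, refSign (permMatching τ b) b =
      if τ b.2 < (τ b.2).succAbove b.1 ∧ τ.symm ((τ b.2).succAbove b.1) < b.2 then -1 else 1 := by
    intro b
    have h2 := succAbove_permMatching_snd τ b
    have h3 := succAbove_eq_succ_iff (τ.symm (permMatching τ b).1) (permMatching τ b).2
    rw [h2, permMatching_fst] at h3
    rw [refSign, permMatching_fst]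
    simp only [succAbove_eq_succ_iff, h3]
  rw [Perm.sign_eq_prod_prod_Iio, Fintype.prod_prod_type_right]
  refine Finset.prod_congr rfl fun j _ => ?_
  simp only [key]
  -- The omitted column `τ j` would contribute `1`, so the product may run over all columns and be
  -- reindexed by `τ`.
  have h := Fin.prod_univ_succAbove
    (fun i => if τ j < i ∧ τ.symm i < j then (-1 : ℤˣ) else 1) (τ j)
  simp only [lt_irrefl, false_and, if_false, one_mul] at h
  rw [← h, ← Equiv.prod_comp τ, ← Finset.prod_subset (Finset.subset_univ (Finset.Iio j))]
  · refine Finset.prod_congr rfl fun m hm => ?_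
    have hm' : m < j := Finset.mem_Iio.1 hm
    have : τ m ≠ τ j := τ.injective.ne hm'.ne
    rcases this.lt_or_gt with h | h
    · simp [h, h.not_gt]
    · simp [h, h.not_gt, hm']
  · intro m _ hm
    simp only [Finset.mem_Iio] at hm
    simp [hm]

/-- The edge of the permutation spanning forest of `τ` that leaves a given black vertex. -/
def forestEdge (τ : Perm (Fin (k + 1))) (b : Black k) : BEdge k :=
  if b.1.castSucc < τ b.2 then (.even b.1.castSucc b.2, false) else (.even b.1.succ b.2, true)

theorem forestEdge_mem (τ : Perm (Fin (k + 1))) (b : Black k) :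
    forestEdge τ b ∈ permForest τ := by
  rw [mem_permForest, forestEdge]
  split_ifs with h
  · exact h
  · simpa [InPermForest, Fin.lt_def, Nat.lt_succ_iff] using h

theorem tail_forestEdge (τ : Perm (Fin (k + 1))) (b : Black k) :
    (forestEdge τ b).tail = .black b := by
  unfold forestEdge
  split_ifs <;> simp [BEdge.tail, end₁_castSucc, end₀_succ]

theorem face_forestEdge (τ : Perm (Fin (k + 1))) (b : Black k) :
    (forestEdge τ b).face = .even ((τ b.2).succAbove b.1) b.2 := by
  unfold forestEdge Fin.succAbove
  split_ifs <;> rfl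

/-- Exactly one forest edge leaves each black vertex and none leaves a root, so the edges can be
indexed by the black vertices. -/
theorem prod_permForest {R : Type*} [CommRing R] (a : Face k → R) (d : Fin k → R)
    (τ : Perm (Fin (k + 1))) :
    ∏ e ∈ permForest τ, (a e.face - colWeight d e.tail) =
      ∏ b : Black k, (a (.even ((τ b.2).succAbove b.1) b.2) - d b.1) := by
  symm
  refine Finset.prod_bij (fun b _ => forestEdge τ b) (fun b _ => forestEdge_mem τ b) ?_ ?_ ?_
  · intro b _ b' _ h
    have := congrArg BEdge.tail h
    simpa [tail_forestEdge] using this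
  · intro e he
    obtain ⟨b, hb⟩ : ∃ b, e.tail = .black b := by
      rw [mem_permForest] at he
      rcases e with ⟨⟨i, j⟩ | ⟨i, j⟩, s⟩ <;> cases s
      · obtain ⟨i', -, h⟩ := tail_of_lt (j := j) he
        exact ⟨_, h⟩
      · obtain ⟨i', -, h⟩ := tail_of_gt (j := j) he
        exact ⟨_, h⟩
      · exact he.elim
      · exact he.elim
    obtain ⟨e', -, huniq⟩ := (isPermForest_permForest τ).forest.out (.black b) (by simp)
    exact ⟨b, Finset.mem_univ _, (huniq _ ⟨forestEdge_mem τ b, tail_forestEdge τ b⟩).trans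
      (huniq _ ⟨he, hb⟩).symm⟩
  · intro b _
    rw [face_forestEdge, tail_forestEdge, colWeight]

theorem sum_prod_signedWeight {R : Type*} [CommRing R] (a : Face k → R) (d : Fin k → R) :
    ∑ σ : Black k ≃ White k, ∏ b, signedWeight (fun i j => a (.even i j)) d (σ b) b =
      ∑ τ : Perm (Fin (k + 1)), ((Perm.sign τ : ℤ) : R) *
        ∏ e ∈ permForest τ, (a e.face - colWeight d e.tail) := by
  classical
  rw [← Finset.sum_filter_add_sum_filter_not _ RowInjective, sum_not_rowInjective, add_zero]
  symm
  refine Finset.sum_of_injOn permMatching permMatching_injective.injOn ?_ ?_ ?_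
  · intro τ _
    simpa using rowInjective_permMatching τ
  -- A row-injective bijection not arising from a permutation pairs some non-adjacent vertices,
  -- hence has weight `0`.
  · intro σ hσ hne
    by_contra h0
    have hadj : ∀ b, Adj (σ b) b := fun b => by
      by_contra hb
      exact h0 (Finset.prod_eq_zero (Finset.mem_univ b) (if_neg hb))
    obtain ⟨τ, hτ⟩ := exists_eq_permMatching hadj (Finset.mem_filter.1 hσ).2
    exact hne ⟨τ, by simp, hτ⟩
  · intro τ _
    simp only [signedWeight, adj_permMatching, if_true, Finset.prod_mul_distrib]
    rw [prod_permForest, ← prod_refSign_permMatching]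
    simp [permMatching_fst]

end Combinatorics

/-! ### Expansion of the partition function over perfect matchings -/

section Dimers

variable {k : ℕ}

theorem dEdge_eq_of_isOrientedDimer {M : Finset (DEdge k)} (hM : IsOrientedDimer M) {e e' : DEdge k}
    (he : e ∈ M) (he' : e' ∈ M) (h : e.1.black = e'.1.black) : e = e' :=
  (hM.2 e'.1.black).unique ⟨he, h⟩ ⟨he', rfl⟩

open Classical in
-- An oriented dimer configuration amounts to a bijection `σ` and, for each `b`, a directed edge
-- between `b` and `σ b`. If these are not adjacent, the inner sum is empty.
theorem sum_isOrientedDimer {R : Type*} [CommRing R] (x : DEdge k → R) :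
    ∑ M : Finset (DEdge k) with IsOrientedDimer M, ∏ e ∈ M, x e =
      ∑ σ : Black k ≃ White k, ∏ b,
        ∑ e : DEdge k with e.1.white = σ b ∧ e.1.black = b, x e := by
  simp only [Finset.prod_univ_sum]
  rw [Finset.sum_sigma']
  have hmem : ∀ p : (_ : Black k ≃ White k) × (Black k → DEdge k),
      p ∈ (Finset.univ.sigma fun σ : Black k ≃ White k => Fintype.piFinset fun b =>
        ({e : DEdge k | e.1.white = σ b ∧ e.1.black = b} : Finset _)) ↔
      ∀ b, (p.2 b).1.white = p.1 b ∧ (p.2 b).1.black = b := by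
    intro p
    simp [Fintype.mem_piFinset]
  symm
  refine Finset.sum_bij (fun p _ => Finset.univ.image p.2) ?_ ?_ ?_ ?_
  · intro p hp
    rw [hmem] at hp
    simp only [Finset.mem_filter, Finset.mem_univ, true_and]
    constructor
    · intro w
      refine ⟨p.2 (p.1.symm w), ⟨by simp, by simp [(hp _).1]⟩, ?_⟩
      rintro e ⟨he, rfl⟩
      obtain ⟨b, -, rfl⟩ := Finset.mem_image.1 he
      simp [(hp _).1]
    · intro b
      refine ⟨p.2 b, ⟨by simp, (hp b).2⟩, ?_⟩
      rintro e ⟨he, rfl⟩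
      obtain ⟨b, -, rfl⟩ := Finset.mem_image.1 he
      simp [(hp _).2]
  · rintro ⟨σ, F⟩ hp ⟨σ', F'⟩ hp' h
    rw [hmem] at hp hp'
    simp only at h hp hp'
    have hF : F = F' := by
      funext b
      have : F b ∈ Finset.univ.image F' := by rw [← h]; simp
      obtain ⟨b', -, hb'⟩ := Finset.mem_image.1 this
      have : b' = b := by rw [← (hp' b').2, hb', (hp b).2]
      rw [← hb', this]
    subst hF
    have hσ : σ = σ' := Equiv.ext fun b => by rw [← (hp b).1, (hp' b).1]
    rw [hσ]
  · intro M hM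
    have hM : IsOrientedDimer M := by simpa using hM
    choose F hF _ using fun b => (hM.2 b).exists.imp fun e he => (⟨he, trivial⟩ : _ ∧ True)
    have hbij : Function.Bijective fun b => (F b).1.white := by
      constructor
      · intro b b' h
        have := (hM.1 (F b').1.white).unique ⟨(hF b).1, h⟩ ⟨(hF b').1, rfl⟩
        rw [← (hF b).2, this, (hF b').2]
      · intro w
        obtain ⟨e, he, rfl⟩ := (hM.1 w).exists
        exact ⟨e.1.black, by
          simp only [dEdge_eq_of_isOrientedDimer hM (hF e.1.black).1 he (hF _).2]⟩
    refine ⟨⟨Equiv.ofBijective _ hbij, F⟩, (hmem _).2 fun b => ⟨rfl, (hF b).2⟩, ?_⟩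
    ext e
    simp only [Finset.mem_image, Finset.mem_univ, true_and]
    constructor
    · rintro ⟨b, rfl⟩
      exact (hF b).1
    · intro he
      exact ⟨e.1.black, dEdge_eq_of_isOrientedDimer hM (hF _).1 he (hF _).2⟩
  · intro p hp
    rw [hmem] at hp
    refine (Finset.prod_image fun b _ b' _ h => ?_).symm
    rw [← (hp b).2, h, (hp b').2]

end Dimers

/-! ### Sign functions with trivial holonomy around the faces -/

section Gauge

/-- The values at white vertices of the potential of `ψ`, built row by row from the bottom. -/
def whitePotential (ψ : ℕ → ℕ → ℕ → ℕ → ℤˣ) : ℕ → ℕ → ℤˣ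
  | 0, 0 => 1
  | 0, i + 1 => whitePotential ψ 0 i * ψ i 0 i 0 * ψ (i + 1) 0 i 0
  | j + 1, 0 => whitePotential ψ j 0 * ψ 0 j 0 (j + 1) * ψ 0 (j + 1) 0 (j + 1)
  | j + 1, i + 1 => whitePotential ψ j i * ψ i j i (j + 1) * ψ (i + 1) (j + 1) i (j + 1)

/-- The values at black vertices of the potential of `ψ`. -/
def blackPotential (ψ : ℕ → ℕ → ℕ → ℕ → ℤˣ) : ℕ → ℕ → ℤˣ
  | 0, i => whitePotential ψ 0 i * ψ i 0 i 0
  | j + 1, i => whitePotential ψ j i * ψ i j i (j + 1)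

/-- The potential is defined along a spanning tree, on whose edges the formula is automatic. Each
remaining edge is the last unknown side of an internal face, and the trivial product around that
face settles it, row by row. -/
theorem eq_potential (k : ℕ) (ψ : ℕ → ℕ → ℕ → ℕ → ℤˣ)
    (hodd : ∀ i j, i < k → j < k →
      ψ i j i j * ψ (i + 1) j i j * ψ i j i (j + 1) * ψ (i + 1) j i (j + 1) = 1)
    (heven : ∀ i j, i + 1 < k → j + 1 < k →
      ψ (i + 1) j i (j + 1) * ψ (i + 1) j (i + 1) (j + 1) * ψ (i + 1) (j + 1) i (j + 1) *
        ψ (i + 1) (j + 1) (i + 1) (j + 1) = 1) (j : ℕ) (hj : j < k) :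
    ∀ i, i < k →
      ψ i j i j = whitePotential ψ j i * blackPotential ψ j i ∧
      ψ (i + 1) j i j = whitePotential ψ j (i + 1) * blackPotential ψ j i ∧
      ψ i j i (j + 1) = whitePotential ψ j i * blackPotential ψ (j + 1) i ∧
      ψ (i + 1) j i (j + 1) = whitePotential ψ j (i + 1) * blackPotential ψ (j + 1) i := by
  have cancel : ∀ g x : ℤˣ, x = g * (g * x) := by decide
  have cancel' : ∀ g x y : ℤˣ, y = g * x * y * (g * x) := by decide
  have close : ∀ x g g' h h' : ℤˣ, g * h * (g' * h) * (g * h') * x = 1 → x = g' * h' := by decide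
  have close' : ∀ x g g' h h' : ℤˣ, g * h * (g * h') * (g' * h) * x = 1 → x = g' * h' := by decide
  -- Of the two upper edges of an odd face, the left one lies in the tree and the right one is given
  -- by the face.
  have hD : ∀ i, i < k → ψ i j i j = whitePotential ψ j i * blackPotential ψ j i →
      ψ (i + 1) j i j = whitePotential ψ j (i + 1) * blackPotential ψ j i →
      ψ i j i (j + 1) = whitePotential ψ j i * blackPotential ψ (j + 1) i ∧
      ψ (i + 1) j i (j + 1) = whitePotential ψ j (i + 1) * blackPotential ψ (j + 1) i := by
    intro i hi h1 h2
    have h3 : ψ i j i (j + 1) = whitePotential ψ j i * blackPotential ψ (j + 1) i := cancel _ _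
    refine ⟨h3, close _ (whitePotential ψ j i) _ (blackPotential ψ j i) _ ?_⟩
    rw [← h1, ← h2, ← h3, hodd i j hi hj]
  suffices hAB : ∀ i, i < k → ψ i j i j = whitePotential ψ j i * blackPotential ψ j i ∧
      ψ (i + 1) j i j = whitePotential ψ j (i + 1) * blackPotential ψ j i from fun i hi =>
    ⟨(hAB i hi).1, (hAB i hi).2, hD i hi (hAB i hi).1 (hAB i hi).2⟩
  cases j with
  | zero =>
    intro i hi
    exact ⟨cancel _ _, by simp only [whitePotential, blackPotential]; exact cancel' _ _ _⟩
  | succ j =>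
    have ih := eq_potential k ψ hodd heven j (by omega)
    intro i hi
    induction i with
    | zero =>
      constructor <;> simp only [whitePotential, blackPotential] <;> exact cancel' _ _ _
    | succ i ihi =>
      refine ⟨?_, by simp only [whitePotential, blackPotential]; exact cancel' _ _ _⟩
      -- The fourth side of an even face: two sides are known from the row below and one from the
      -- preceding column.
      refine close' _ (whitePotential ψ j (i + 1)) _ (blackPotential ψ (j + 1) i) _ ?_
      rw [← (ih i (by omega)).2.2.2, ← (ih (i + 1) hi).2.2.1, ← (ihi (by omega)).2,
        heven i j hi hj]

end Gauge

/-! ### Reduction of a Kasteleyn orientation to the reference signs -/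

section Kasteleyn

variable {k : ℕ}

theorem isEdge_iff_adj (w : White k) (b : Black k) :
    (|(Black.pos b).1 - (White.pos w).1| = 1 ∧ |(Black.pos b).2 - (White.pos w).2| = 1) ↔
      Adj w b := by
  simp only [Black.pos, White.pos, Adj, Fin.ext_iff, Fin.val_castSucc, Fin.val_succ,
    abs_eq (zero_le_one' ℤ)]
  omega

theorem Edge.adj (e : Edge k) : Adj e.white e.black := (isEdge_iff_adj _ _).1 e.2

/-- The edge with given ends. -/
def mkEdge (w : White k) (b : Black k) (h : Adj w b) : Edge k := ⟨(w, b), (isEdge_iff_adj w b).2 h⟩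

/-- The edge has slope `1`. -/
def SlopeOne (w : White k) (b : Black k) : Prop := w.1 = b.1.castSucc ↔ b.2 = w.2.succ

instance (w : White k) (b : Black k) : Decidable (SlopeOne w b) := by
  unfold SlopeOne; infer_instance

theorem rightFace_true (e : Edge k) : DEdge.rightFace (e, true) =
    if SlopeOne e.white e.black then .odd e.black.1 e.white.2 else .even e.white.1 e.black.2 := by
  have h := e.adj
  rw [DEdge.rightFace]
  refine if_congr ?_ rfl rfl
  simp only [Adj, Fin.ext_iff, Fin.val_castSucc, Fin.val_succ] at h
  simp only [OnRight, DEdge.tailPos, DEdge.headPos, DEdge.oddFace, Face.pos, if_true, SlopeOne,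
    Fin.ext_iff, Fin.val_castSucc, Fin.val_succ, Black.pos, White.pos]
  obtain ⟨h1 | h1, h2 | h2⟩ := h <;> rw [h1, h2] <;> push_cast <;> ring_nf <;> simp

theorem rightFace_false (e : Edge k) : DEdge.rightFace (e, false) =
    if SlopeOne e.white e.black then .even e.white.1 e.black.2 else .odd e.black.1 e.white.2 := by
  have h := e.adj
  rw [DEdge.rightFace, ← ite_not]
  refine if_congr ?_ rfl rfl
  simp only [Adj, Fin.ext_iff, Fin.val_castSucc, Fin.val_succ] at h
  simp only [OnRight, DEdge.tailPos, DEdge.headPos, DEdge.oddFace, Face.pos, SlopeOne,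
    Fin.ext_iff, Fin.val_castSucc, Fin.val_succ, Black.pos, White.pos]
  obtain ⟨h1 | h1, h2 | h2⟩ := h <;> rw [h1, h2] <;> push_cast <;> ring_nf <;> simp

theorem rightFace_eq_or (e : Edge k) (f : Face k) :
    (DEdge.rightFace (e, true) = f ∨ DEdge.rightFace (e, false) = f) ↔
      (Face.even e.white.1 e.black.2 = f ∨ Face.odd e.black.1 e.white.2 = f) := by
  rw [rightFace_true, rightFace_false]
  split_ifs
  · exact or_comm
  · exact Iff.rfl

/-- The ratio between an orientation and the reference Kasteleyn orientation that is `1` on the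
edges directed from white to black with difference `(1, -1)` and `-1` on the others, as a function
of the indices `i, j` of the white end and `m, n` of the black end. -/
def signRatio (φ : DEdge k → ℤˣ) (i j m n : ℕ) : ℤˣ :=
  if h : ((i < k + 1 ∧ j < k) ∧ m < k ∧ n < k + 1) ∧ (i = m ∨ i = m + 1) ∧ (n = j ∨ n = j + 1) then
    φ (mkEdge (⟨i, h.1.1.1⟩, ⟨j, h.1.1.2⟩) (⟨m, h.1.2.1⟩, ⟨n, h.1.2.2⟩)
      (by simpa only [Adj, Fin.ext_iff, Fin.val_castSucc, Fin.val_succ] using h.2), true) *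
      if i = m ∧ n = j then 1 else -1
  else 1

theorem signRatio_edge (φ : DEdge k → ℤˣ) (e : Edge k) :
    signRatio φ e.white.1 e.white.2 e.black.1 e.black.2 =
      φ (e, true) * if (e.white.1 : ℕ) = e.black.1 ∧ (e.black.2 : ℕ) = e.white.2 then 1 else -1 := by
  have h := e.adj
  simp only [Adj, Fin.ext_iff, Fin.val_castSucc, Fin.val_succ] at h
  exact dif_pos ⟨⟨⟨e.white.1.2, e.white.2.2⟩, e.black.1.2, e.black.2.2⟩, h⟩

/-- Three of the four reference signs are `-1`; their product `-1` cancels the one in the Kasteleyn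
condition. The same count applies to even faces. -/
theorem signRatio_odd {φ : DEdge k → ℤˣ} (hφ : IsKasteleyn φ) (i j : ℕ) (hi : i < k) (hj : j < k) :
    signRatio φ i j i j * signRatio φ (i + 1) j i j * signRatio φ i j i (j + 1) *
      signRatio φ (i + 1) j i (j + 1) = 1 := by
  have hf := hφ.face (.odd ⟨i, hi⟩ ⟨j, hj⟩) (by
    simp only [Face.IsInternal, Face.pos]; omega)
  simp only [rightFace_eq_or] at hf
  let w : White k := (⟨i, by omega⟩, ⟨j, hj⟩)
  let w' : White k := (⟨i + 1, by omega⟩, ⟨j, hj⟩)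
  let b : Black k := (⟨i, hi⟩, ⟨j, by omega⟩)
  let b' : Black k := (⟨i, hi⟩, ⟨j + 1, by omega⟩)
  have h1 : Adj w b := by simp [Adj, w, b]
  have h2 : Adj w' b := by simp [Adj, w', b]
  have h3 : Adj w b' := by simp [Adj, w, b']
  have h4 : Adj w' b' := by simp [Adj, w', b']
  have hset : ({e : Edge k | Face.even e.white.1 e.black.2 = .odd ⟨i, hi⟩ ⟨j, hj⟩ ∨
      Face.odd e.black.1 e.white.2 = .odd ⟨i, hi⟩ ⟨j, hj⟩} : Finset (Edge k)) =
      {mkEdge w b h1, mkEdge w' b h2, mkEdge w b' h3, mkEdge w' b' h4} := by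
    ext ⟨⟨⟨x, y⟩, ⟨m, n⟩⟩, he⟩
    have hadj := (isEdge_iff_adj _ _).1 he
    simp only [Adj, Fin.ext_iff, Fin.val_castSucc, Fin.val_succ] at hadj
    simp only [mkEdge, w, w', b, b', Finset.mem_filter, Finset.mem_univ, true_and, reduceCtorEq,
      false_or, Face.odd.injEq, Finset.mem_insert, Finset.mem_singleton, Subtype.mk.injEq,
      Prod.mk.injEq, Edge.white, Edge.black, Fin.ext_iff]
    omega
  have e1 := signRatio_edge φ (mkEdge w b h1)
  have e2 := signRatio_edge φ (mkEdge w' b h2)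
  have e3 := signRatio_edge φ (mkEdge w b' h3)
  have e4 := signRatio_edge φ (mkEdge w' b' h4)
  rw [hset, Finset.prod_insert (by simp [mkEdge, w, w', b, b']),
    Finset.prod_insert (by simp [mkEdge, w, w', b, b']),
    Finset.prod_insert (by simp [mkEdge, w, w', b']), Finset.prod_singleton] at hf
  simp [mkEdge, w, w', b, b', Edge.white, Edge.black] at e1 e2 e3 e4 hf
  rw [e1, e2, e3, e4]
  simp only [mul_neg, neg_mul, neg_neg, mul_assoc, hf]

theorem signRatio_even {φ : DEdge k → ℤˣ} (hφ : IsKasteleyn φ) (i j : ℕ) (hi : i + 1 < k)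
    (hj : j + 1 < k) :
    signRatio φ (i + 1) j i (j + 1) * signRatio φ (i + 1) j (i + 1) (j + 1) *
      signRatio φ (i + 1) (j + 1) i (j + 1) * signRatio φ (i + 1) (j + 1) (i + 1) (j + 1) = 1 := by
  have hf := hφ.face (.even ⟨i + 1, by omega⟩ ⟨j + 1, by omega⟩) (by
    simp only [Face.IsInternal, Face.pos]; omega)
  simp only [rightFace_eq_or] at hf
  let w : White k := (⟨i + 1, by omega⟩, ⟨j, by omega⟩)
  let w' : White k := (⟨i + 1, by omega⟩, ⟨j + 1, hj⟩)
  let b : Black k := (⟨i, by omega⟩, ⟨j + 1, by omega⟩)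
  let b' : Black k := (⟨i + 1, hi⟩, ⟨j + 1, by omega⟩)
  have h1 : Adj w b := by simp [Adj, w, b]
  have h2 : Adj w b' := by simp [Adj, w, b']
  have h3 : Adj w' b := by simp [Adj, w', b]
  have h4 : Adj w' b' := by simp [Adj, w', b']
  have hset : ({e : Edge k | Face.even e.white.1 e.black.2 =
        .even ⟨i + 1, by omega⟩ ⟨j + 1, by omega⟩ ∨
      Face.odd e.black.1 e.white.2 = .even ⟨i + 1, by omega⟩ ⟨j + 1, by omega⟩} :
        Finset (Edge k)) =
      {mkEdge w b h1, mkEdge w b' h2, mkEdge w' b h3, mkEdge w' b' h4} := by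
    ext ⟨⟨⟨x, y⟩, ⟨m, n⟩⟩, he⟩
    have hadj := (isEdge_iff_adj _ _).1 he
    simp only [Adj, Fin.ext_iff, Fin.val_castSucc, Fin.val_succ] at hadj
    simp only [mkEdge, w, w', b, b', Finset.mem_filter, Finset.mem_univ, true_and, reduceCtorEq,
      or_false, Face.even.injEq, Finset.mem_insert, Finset.mem_singleton, Subtype.mk.injEq,
      Prod.mk.injEq, Edge.white, Edge.black, Fin.ext_iff]
    omega
  have e1 := signRatio_edge φ (mkEdge w b h1)
  have e2 := signRatio_edge φ (mkEdge w b' h2)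
  have e3 := signRatio_edge φ (mkEdge w' b h3)
  have e4 := signRatio_edge φ (mkEdge w' b' h4)
  rw [hset, Finset.prod_insert (by simp [mkEdge, w, w', b, b']),
    Finset.prod_insert (by simp [mkEdge, w, w', b, b']),
    Finset.prod_insert (by simp [mkEdge, w', b, b']), Finset.prod_singleton] at hf
  simp [mkEdge, w, w', b, b', Edge.white, Edge.black] at e1 e2 e3 e4 hf
  rw [e1, e2, e3, e4]
  simp only [mul_neg, neg_mul, neg_neg, mul_assoc, hf]

theorem exists_potential {φ : DEdge k → ℤˣ} (hφ : IsKasteleyn φ) :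
    ∃ (g : White k → ℤˣ) (h : Black k → ℤˣ), ∀ e : Edge k,
      φ (e, true) = g e.white * h e.black *
        if (e.white.1 : ℕ) = e.black.1 ∧ (e.black.2 : ℕ) = e.white.2 then 1 else -1 := by
  refine ⟨fun w => whitePotential (signRatio φ) w.2 w.1,
    fun b => blackPotential (signRatio φ) b.2 b.1, fun e => ?_⟩
  have key := eq_potential k (signRatio φ) (signRatio_odd hφ) (signRatio_even hφ) e.white.2
    e.white.2.2 e.black.1 e.black.1.2
  have hadj := e.adj
  simp only [Adj, Fin.ext_iff, Fin.val_castSucc, Fin.val_succ] at hadj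
  have he : signRatio φ e.white.1 e.white.2 e.black.1 e.black.2 =
      whitePotential (signRatio φ) e.white.2 e.white.1 *
        blackPotential (signRatio φ) e.black.2 e.black.1 := by
    obtain ⟨h1 | h1, h2 | h2⟩ := hadj <;> rw [h1, h2]
    exacts [key.1, key.2.2.1, key.2.1, key.2.2.2]
  rw [← he, signRatio_edge, mul_assoc, Int.units_mul_self, mul_one]

theorem sum_dEdge_eq {R : Type*} [CommRing R] {φ : DEdge k → ℤˣ} (hφ : IsKasteleyn φ)
    {g : White k → ℤˣ} {h : Black k → ℤˣ} (hgh : ∀ e : Edge k,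
      φ (e, true) = g e.white * h e.black *
        if (e.white.1 : ℕ) = e.black.1 ∧ (e.black.2 : ℕ) = e.white.2 then 1 else -1)
    {a : Face k → R} {d : Fin k → R} (had : ∀ i j, a (.odd i j) = d i) (w : White k)
    (b : Black k) :
    ∑ e : DEdge k with e.1.white = w ∧ e.1.black = b, ((φ e : ℤ) : R) * a e.rightFace =
      (((g w : ℤ) : R) * ((h b : ℤ) : R)) * signedWeight (fun i j => a (.even i j)) d w b := by
  by_cases hadj : Adj w b
  · have hset : ({e : DEdge k | e.1.white = w ∧ e.1.black = b} : Finset (DEdge k)) =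
        {(mkEdge w b hadj, true), (mkEdge w b hadj, false)} := by
      ext ⟨⟨⟨w', b'⟩, he⟩, s⟩
      rw [Finset.mem_filter]
      cases s <;> simp only [Edge.white, Edge.black, mkEdge, Finset.mem_univ, true_and,
        Finset.mem_insert, Finset.mem_singleton, Prod.mk.injEq, Subtype.mk.injEq,
        reduceCtorEq, and_false, and_true, or_false, false_or]
    have hskew : φ (mkEdge w b hadj, false) = -φ (mkEdge w b hadj, true) :=
      hφ.skew (mkEdge w b hadj, true)
    rw [hset, Finset.sum_pair (by simp), hskew, hgh, rightFace_true, rightFace_false, signedWeight,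
      if_pos hadj]
    have hw : (mkEdge w b hadj).white = w := rfl
    have hb : (mkEdge w b hadj).black = b := rfl
    rw [hw, hb]
    simp only [Adj, Fin.ext_iff, Fin.val_castSucc, Fin.val_succ] at hadj
    simp only [refSign, SlopeOne, Fin.ext_iff, Fin.val_castSucc, Fin.val_succ]
    obtain ⟨h1 | h1, h2 | h2⟩ := hadj <;> simp [h1, h2, had] <;> ring
  · rw [signedWeight, if_neg hadj, mul_zero]
    refine Finset.sum_eq_zero fun e he => ?_
    obtain ⟨rfl, rfl⟩ := (Finset.mem_filter.1 he).2
    exact absurd e.1.adj hadj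

end Kasteleyn

end AztecDSKP

open AztecDSKP in
theorem theorem5p5 {R : Type*} [CommRing R] (k : ℕ) (hk : 1 ≤ k)
    (φ : DEdge k → ℤˣ) (hφ : IsKasteleyn φ) :
    ∃ ε : ℤˣ, ∀ (a : Face k → R) (d : Fin k → R), (∀ i j : Fin k, a (Face.odd i j) = d i) →
      partitionFunction k a φ =
        ((ε : ℤ) : R) * ∑ τ : Equiv.Perm (Fin (k + 1)), ((Equiv.Perm.sign τ : ℤ) : R) *
          ∏ e ∈ permForest τ, (a (BEdge.face e) - colWeight d (BEdge.tail e)) := by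
  obtain ⟨g, h, hgh⟩ := exists_potential hφ
  refine ⟨(∏ w, g w) * ∏ b, h b, fun a d had => ?_⟩
  rw [← sum_prod_signedWeight, partitionFunction, sum_isOrientedDimer, Finset.mul_sum]
  refine Finset.sum_congr rfl fun σ _ => ?_
  simp only [sum_dEdge_eq hφ hgh had, Finset.prod_mul_distrib]
  -- Since `σ` is bijective, each white sign occurs once, so the gauge factor is the same for all
  -- matchings.
  rw [σ.prod_comp fun w => ((g w : ℤ) : R)]
  push_cast
  rfl
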